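/- **Theorem (Lower bound).** There exist universal constants $C_1, C_2, B > 0$ such that the following holds for all integers $d, m, c \ge 1$ and all reals $\varepsilon \in [0,1]$, $\delta \in (0, 1/16]$ with $$d \ \ge\ \log(1/\delta)\ \ge\ c/B .$$ Let $M^{(1)}, \dots, M^{(c)} \in \mathbb{R}^{m\times d}$ be random matrices all of whose $cmd$ entries are independent Rademacher variables (uniform on $\{-1,1\}$), and let $$M = \tfrac{1}{\sqrt m}\, M^{(1)} \bullet \dots \bullet M^{(c)} \in \mathbb{R}^{m \times d^c},$$ where $\bullet$ is the face-splitting product, i.e. the $j$-th row of $M^{(1)} \bullet \dots \bullet M^{(c)}$ is the tensor product $M^{(1)}_j \otimes \dots \otimes M^{(c)}_j$ of the $j$-th rows of the factors. Then there exists a (deterministic) unit vector $y \in \mathbb{R}^{d^c}$ such that, if $$m < C_1 \max\left\{ 3^c\, \varepsilon^{-2}\, \frac{\log(1/\delta)}{c},\ \ \varepsilon^{-1} \left(\frac{C_2 \log(1/\delta)}{c}\right)^{c} \right\},$$ then $$\Pr\Big[\, \big|\, \|My\|_2^2 - 1 \,\big| > \varepsilon \Big] > \delta .$$ For $\varepsilon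 = 0$ the right-hand side of the condition on $m$ is read as $+\infty$. -/

import Mathlib

open MeasureTheory ProbabilityTheory

/-- The face-splitting product `M⁽¹⁾ • ⋯ • M⁽ᶜ⁾` (transposed Khatri-Rao product): row `j` is the
tensor product of the `j`-th rows of the factors. The `d ^ c` coordinates of
`ℝ^d ⊗ ⋯ ⊗ ℝ^d` are indexed by the multi-indices `k : Fin c → Fin d`. -/
def faceSplitting {c m d : ℕ} (M : Fin c → Matrix (Fin m) (Fin d) ℝ) :
    Matrix (Fin m) (Fin c → Fin d) ℝ :=
  Matrix.of fun j k => ∏ i, M i j (k i)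

/-- The Rademacher distribution: the values `1` and `-1` with probability `1/2` each. -/
noncomputable def rademacher : Measure ℝ :=
  (2⁻¹ : ENNReal) • Measure.dirac 1 + (2⁻¹ : ENNReal) • Measure.dirac (-1)

/-- `M⁽¹⁾, …, M⁽ᶜ⁾` are random `m × d` matrices, all of whose `c * m * d` entries are
(jointly) independent Rademacher random variables. -/
structure IsIndepRademacher {c m d : ℕ} {Ω : Type*} [MeasurableSpace Ω] (P : Measure Ω)
    (M : Fin c → Ω → Matrix (Fin m) (Fin d) ℝ) : Prop where
  hasLaw : ∀ i j k, HasLaw (fun ω => M i ω j k) rademacher P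
  indep : iIndepFun (fun (q : Fin c × Fin m × Fin d) (ω : Ω) => M q.1 ω q.2.1 q.2.2) P

/-- The sketching matrix `M = (1/√m) M⁽¹⁾ • ⋯ • M⁽ᶜ⁾`, as a random matrix. -/
noncomputable def tensorSketch {c m d : ℕ} {Ω : Type*}
    (M : Fin c → Ω → Matrix (Fin m) (Fin d) ℝ) (ω : Ω) : Matrix (Fin m) (Fin c → Fin d) ℝ :=
  (1 / √(m : ℝ)) • faceSplitting fun i => M i ω

open scoped BigOperators

/-! ### Tails of i.i.d. sums over a finite uniform space -/

section FiniteExpectation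

variable {α : Type*} [Fintype α]

/-! Put `L = log (1/δ)`, `u = L/c`, `h = ⌊u/4⌋`. For `y = w ⊗ ⋯ ⊗ w`, `‖My‖²` is the mean over the
`m` independent rows of `rowForm w`, a product of `c` independent squares. Two choices of `w`
suffice, and all probabilities become counts of sign patterns
(`IsIndepRademacher.expect_le_measureReal`).

Heavy tail: if `2εm < (2h)^c`, let `w` be flat on `2h` coordinates. With probability `2^(-2hc)` all
relevant signs of one row are `1` and that row contributes `(2h)^c`; flipping half the signs in one
factor makes it contribute `0`. The two sums differ by more than `2εm`, so one of them deviates by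
more than `εm` (`expect_abs_sum_rowForm_flatVec_ge`).

Gaussian range: otherwise let `w` be flat on all `d` coordinates. A row has mean `1`, variance about
`3^c` and fourth central moment at most `2·105^c`. The hypothesis on `m` forces its first bound, and
failure of the first case makes `m` at least of order `12^c u`. Split the rows into `h` blocks: each
exceeds its mean by a fixed multiple of its standard deviation with probability at least `1/20`,
hence all do with probability at least `20^(-h) > exp (-L)` (`exp_neg_lt_expect_rowForm`). -/

theorem expect_fin_cons {n : ℕ} (f : (Fin (n + 1) → α) → ℝ) :
    (𝔼 x, f x) = 𝔼 a, 𝔼 y, f (Fin.cons a y) := by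
  rw [← Finset.expect_product', Finset.univ_product_univ]
  exact (Fintype.expect_equiv (Fin.consEquiv fun _ => α) _ _ fun _ => rfl).symm

theorem expect_fin_append {m n : ℕ} (f : (Fin (m + n) → α) → ℝ) :
    (𝔼 x, f x) = 𝔼 a, 𝔼 b, f (Fin.append a b) := by
  rw [← Finset.expect_product', Finset.univ_product_univ]
  exact (Fintype.expect_equiv (Fin.appendEquiv m n) _ _ fun _ => rfl).symm

theorem expect_prod_fin (c : ℕ) (f : α → ℝ) :
    (𝔼 x : Fin c → α, ∏ i, f (x i)) = (𝔼 a, f a) ^ c := by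
  induction c with
  | zero => simp
  | succ n ih =>
    rw [expect_fin_cons]
    simp only [Fin.prod_univ_succ, Fin.cons_zero, Fin.cons_succ]
    simp_rw [← Finset.mul_expect, ih, ← Finset.expect_mul]
    ring

theorem expect_sum_ge_mul (Z : α → ℝ) (m n : ℕ) (s t : ℝ) :
    (𝔼 x : Fin m → α, if s ≤ ∑ i, Z (x i) then (1 : ℝ) else 0)
      * (𝔼 x : Fin n → α, if t ≤ ∑ i, Z (x i) then (1 : ℝ) else 0)
      ≤ 𝔼 x : Fin (m + n) → α, if s + t ≤ ∑ i, Z (x i) then (1 : ℝ) else 0 := by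
  rw [expect_fin_append, Finset.expect_mul]
  refine Finset.expect_le_expect fun a _ => ?_
  rw [Finset.mul_expect]
  refine Finset.expect_le_expect fun b _ => ?_
  simp only [Fin.sum_univ_add, Fin.append_left, Fin.append_right]
  split_ifs <;> first | (exfalso; linarith) | norm_num

variable [Nonempty α] {Z : α → ℝ} {v F : ℝ}

theorem expect_sum_fin (h1 : (𝔼 a, Z a) = 0) (n : ℕ) :
    (𝔼 x : Fin n → α, ∑ i, Z (x i)) = 0 := by
  induction n with
  | zero => simp
  | succ n ih =>
    rw [expect_fin_cons]
    simp [Fin.sum_univ_succ, Finset.expect_add_distrib, ih, h1]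

theorem expect_sum_fin_sq (h1 : (𝔼 a, Z a) = 0) (h2 : (𝔼 a, Z a ^ 2) = v) (n : ℕ) :
    (𝔼 x : Fin n → α, (∑ i, Z (x i)) ^ 2) = n * v := by
  induction n with
  | zero => simp
  | succ n ih =>
    rw [expect_fin_cons]
    have h (a : α) (y : Fin n → α) : (Z a + ∑ i, Z (y i)) ^ 2
        = Z a ^ 2 + 2 * Z a * (∑ i, Z (y i)) + (∑ i, Z (y i)) ^ 2 := by ring
    simp only [Fin.sum_univ_succ, Fin.cons_zero, Fin.cons_succ, h]
    simp only [Finset.expect_add_distrib, ← Finset.mul_expect, expect_sum_fin h1, ih,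
      Fintype.expect_const, h2, mul_zero]
    push_cast
    ring

theorem expect_sum_fin_pow_four_le (h1 : (𝔼 a, Z a) = 0) (h2 : (𝔼 a, Z a ^ 2) = v)
    (h4 : (𝔼 a, Z a ^ 4) ≤ F) (n : ℕ) :
    (𝔼 x : Fin n → α, (∑ i, Z (x i)) ^ 4) ≤ 3 * n ^ 2 * v ^ 2 + n * F := by
  induction n with
  | zero => simp
  | succ n ih =>
    rw [expect_fin_cons]
    have h (a : α) (y : Fin n → α) : (Z a + ∑ i, Z (y i)) ^ 4
        = Z a ^ 4 + 4 * Z a ^ 3 * (∑ i, Z (y i)) + 6 * Z a ^ 2 * (∑ i, Z (y i)) ^ 2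
          + 4 * (Z a * (∑ i, Z (y i)) ^ 3) + (∑ i, Z (y i)) ^ 4 := by ring
    simp only [Fin.sum_univ_succ, Fin.cons_zero, Fin.cons_succ, h]
    simp only [Finset.expect_add_distrib, ← Finset.mul_expect, expect_sum_fin h1,
      expect_sum_fin_sq h1 h2, ← Finset.expect_mul, Fintype.expect_const, h2, h1]
    push_cast
    nlinarith [sq_nonneg v]

/-- A quartic minorant of a one-sided indicator. If `z` has mean `0`, second moment `1` and fourth
moment at most `4`, its expectation is at least `(1 - 1/2 - 1/4)/5 = 1/20`. -/
theorem one_sided_poly_le (z : ℝ) :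
    (1 / 5) * (1.1 * z + z ^ 2 - z ^ 4 / 8 - 1 / 4) ≤ if 0.15 ≤ z then (1 : ℝ) else 0 := by
  split_ifs with h
  · nlinarith [sq_nonneg (z ^ 2 - 4.84), sq_nonneg (z - 2.2)]
  · push Not at h
    rcases le_total 0 z with h0 | h0
    · nlinarith [sq_nonneg (z ^ 2)]
    · nlinarith [mul_nonneg (neg_nonneg.2 h0) (mul_nonneg (by linarith : 0 ≤ 3.3 - z)
        (sq_nonneg (z + 1.65))), mul_nonneg (neg_nonneg.2 h0) (sq_nonneg (z + 1.65))]

theorem expect_ge_of_moments {β : Type*} [Fintype β] [Nonempty β] {W : β → ℝ} {s : ℝ}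
    (hs : 0 < s) (h1 : (𝔼 x, W x) = 0) (h2 : (𝔼 x, W x ^ 2) = s ^ 2)
    (h4 : (𝔼 x, W x ^ 4) ≤ 4 * s ^ 4) :
    (1 / 20 : ℝ) ≤ 𝔼 x, if 0.15 * s ≤ W x then (1 : ℝ) else 0 := by
  have key (x : β) : (1 / 5) * (1.1 * s⁻¹ * W x + (s ^ 2)⁻¹ * W x ^ 2
      - (s ^ 4)⁻¹ / 8 * W x ^ 4 - 1 / 4) ≤ if 0.15 * s ≤ W x then (1 : ℝ) else 0 := by
    have := one_sided_poly_le (W x / s)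
    simp only [le_div_iff₀ hs] at this
    refine le_trans (le_of_eq ?_) this
    field_simp
  refine le_trans ?_ (Finset.expect_le_expect fun x _ => key x)
  simp only [Finset.expect_add_distrib, Finset.expect_sub_distrib, ← Finset.mul_expect,
    Fintype.expect_const, h1, h2]
  have : (s ^ 4)⁻¹ / 8 * (𝔼 x, W x ^ 4) ≤ 1 / 2 := by
    calc _ ≤ (s ^ 4)⁻¹ / 8 * (4 * s ^ 4) := by gcongr
      _ = 1 / 2 := by field_simp; norm_num
  rw [inv_mul_cancel₀ (by positivity)]
  linarith

theorem expect_sum_ge_sqrt (hv : 0 < v) (h1 : (𝔼 a, Z a) = 0) (h2 : (𝔼 a, Z a ^ 2) = v)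
    (h4 : (𝔼 a, Z a ^ 4) ≤ F) {n : ℕ} (hn : 0 < n) (hF : F ≤ n * v ^ 2) :
    (1 / 20 : ℝ) ≤ 𝔼 x : Fin n → α, if 0.15 * √(n * v) ≤ ∑ i, Z (x i) then (1 : ℝ) else 0 := by
  have hnv : 0 < n * v := by positivity
  refine expect_ge_of_moments (Real.sqrt_pos.2 hnv) (expect_sum_fin h1 n) ?_ ?_
  · rw [expect_sum_fin_sq h1 h2, Real.sq_sqrt hnv.le]
  · refine (expect_sum_fin_pow_four_le h1 h2 h4 n).trans ?_
    have : √(n * v) ^ 4 = (n * v) ^ 2 := by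
      rw [show 4 = 2 * 2 from rfl, pow_mul, Real.sq_sqrt hnv.le]
    rw [this]
    nlinarith [mul_le_mul_of_nonneg_left hF (Nat.cast_nonneg (α := ℝ) n)]

/-- Lower bound for the upper tail of a sum of i.i.d. centred variables in the Gaussian range,
by splitting the sum into `N` blocks of length at least `b`. -/
theorem expect_sum_ge_blocks (hv : 0 < v) (h1 : (𝔼 a, Z a) = 0) (h2 : (𝔼 a, Z a ^ 2) = v)
    (h4 : (𝔼 a, Z a ^ 4) ≤ F) {b : ℕ} (hb : 0 < b) (hF : F ≤ b * v ^ 2) (N : ℕ) :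
    ∀ m : ℕ, (N + 1) * b ≤ m → (1 / 20 : ℝ) ^ (N + 1) ≤
      𝔼 x : Fin m → α, if 0.15 * (N + 1) * √(b * v) ≤ ∑ i, Z (x i) then (1 : ℝ) else 0 := by
  induction N with
  | zero =>
    intro m hm
    -- The final block absorbs all leftover terms, so it may be longer than `b`.
    have hbm : (b : ℝ) ≤ m := by exact_mod_cast (by simpa using hm : b ≤ m)
    have := expect_sum_ge_sqrt hv h1 h2 h4 (n := m) (by omega) (hF.trans (by gcongr))
    rw [zero_add, pow_one]
    refine this.trans (Finset.expect_le_expect fun x _ => ?_)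
    have : 0.15 * ((0 : ℕ) + 1) * √(b * v) ≤ 0.15 * √(m * v) := by
      norm_num
      gcongr
    split_ifs <;> first | (exfalso; linarith) | norm_num
  | succ N ih =>
    intro m hm
    obtain ⟨n, rfl⟩ : ∃ n, m = b + n := ⟨m - b, by
      have : b ≤ (N + 1 + 1) * b := Nat.le_mul_of_pos_left _ (by omega)
      omega⟩
    have hn : (N + 1) * b ≤ n := by linarith
    have hb' := expect_sum_ge_sqrt hv h1 h2 h4 hb hF
    have key := expect_sum_ge_mul Z b n (0.15 * √(b * v)) (0.15 * (N + 1) * √(b * v))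
    rw [show 0.15 * √(b * v) + 0.15 * (N + 1) * √(b * v)
      = 0.15 * ((N + 1 : ℕ) + 1) * √(b * v) by push_cast; ring] at key
    refine le_trans ?_ key
    rw [pow_succ, mul_comm]
    exact mul_le_mul hb' (ih n hn) (by positivity) (by linarith)

end FiniteExpectation

/-! ### Moments of Rademacher sums -/

section Signs

theorem expect_units_int (f : ℤˣ → ℝ) : (𝔼 u, f u) = (f 1 + f (-1)) / 2 := by
  rw [Fintype.expect_eq_sum_div_card, UnitsInt.univ, Finset.sum_pair (by decide)]
  simp

/-- Averaging over one sign cancels the odd powers when `p` is even, so the even moments obey a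
closed recursion; the bounds below have the Gaussian constants `3, 15, 105`. -/
theorem expect_sign_sum_succ (p n : ℕ) :
    (𝔼 x : Fin (n + 1) → ℤˣ, (∑ i, ((x i : ℤ) : ℝ)) ^ p) =
      𝔼 x : Fin n → ℤˣ, (((∑ i, ((x i : ℤ) : ℝ)) + 1) ^ p
        + ((∑ i, ((x i : ℤ) : ℝ)) - 1) ^ p) / 2 := by
  rw [expect_fin_cons, expect_units_int, ← Finset.expect_add_distrib, Finset.expect_div]
  simp [Fin.sum_univ_succ, add_comm, sub_eq_add_neg]

theorem expect_sign_sum_sq (n : ℕ) :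
    (𝔼 x : Fin n → ℤˣ, (∑ i, ((x i : ℤ) : ℝ)) ^ 2) = n := by
  induction n with
  | zero => simp
  | succ n ih =>
    have h (s : ℝ) : ((s + 1) ^ 2 + (s - 1) ^ 2) / 2 = s ^ 2 + 1 := by ring
    simp only [expect_sign_sum_succ, h, Finset.expect_add_distrib, Fintype.expect_const, ih]
    push_cast
    ring

theorem expect_sign_sum_pow_four (n : ℕ) :
    (𝔼 x : Fin n → ℤˣ, (∑ i, ((x i : ℤ) : ℝ)) ^ 4) = 3 * n ^ 2 - 2 * n := by
  induction n with
  | zero => simp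
  | succ n ih =>
    have h (s : ℝ) : ((s + 1) ^ 4 + (s - 1) ^ 4) / 2 = s ^ 4 + 6 * s ^ 2 + 1 := by ring
    simp only [expect_sign_sum_succ, h, Finset.expect_add_distrib, Fintype.expect_const, ih,
      ← Finset.mul_expect, expect_sign_sum_sq]
    push_cast
    ring

theorem expect_sign_sum_pow_six_le (n : ℕ) :
    (𝔼 x : Fin n → ℤˣ, (∑ i, ((x i : ℤ) : ℝ)) ^ 6) ≤ 15 * n ^ 3 := by
  induction n with
  | zero => simp
  | succ n ih =>
    have h (s : ℝ) : ((s + 1) ^ 6 + (s - 1) ^ 6) / 2 = s ^ 6 + 15 * s ^ 4 + 15 * s ^ 2 + 1 := by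
      ring
    simp only [expect_sign_sum_succ, h, Finset.expect_add_distrib, Fintype.expect_const,
      ← Finset.mul_expect, expect_sign_sum_sq, expect_sign_sum_pow_four]
    push_cast
    nlinarith [Nat.cast_nonneg (α := ℝ) n]

theorem expect_sign_sum_pow_eight_le (n : ℕ) :
    (𝔼 x : Fin n → ℤˣ, (∑ i, ((x i : ℤ) : ℝ)) ^ 8) ≤ 105 * n ^ 4 := by
  induction n with
  | zero => simp
  | succ n ih =>
    have h (s : ℝ) : ((s + 1) ^ 8 + (s - 1) ^ 8) / 2
        = s ^ 8 + 28 * s ^ 6 + 70 * s ^ 4 + 28 * s ^ 2 + 1 := by ring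
    simp only [expect_sign_sum_succ, h, Finset.expect_add_distrib, Fintype.expect_const,
      ← Finset.mul_expect, expect_sign_sum_sq, expect_sign_sum_pow_four]
    push_cast
    nlinarith [Nat.cast_nonneg (α := ℝ) n, expect_sign_sum_pow_six_le n]

end Signs

/-! ### Tensor-power test vectors and moments of one row -/

section RowForm

/-- The square of the inner product of a row `r⁽¹⁾ ⊗ ⋯ ⊗ r⁽ᶜ⁾` with `w ⊗ ⋯ ⊗ w`. -/
def rowForm {c d : ℕ} (w : Fin d → ℝ) (r : Fin c → Fin d → ℝ) : ℝ :=
  ∏ i, (∑ k, w k * r i k) ^ 2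

/-- A family of sign patterns, as a family of real vectors. -/
def signRow {c d : ℕ} (s : Fin c → Fin d → ℤˣ) : Fin c → Fin d → ℝ :=
  fun i k => ((s i k : ℤ) : ℝ)

/-- The `c`-fold tensor power of the vector `w`. -/
noncomputable def tensorPow {d : ℕ} (c : ℕ) (w : Fin d → ℝ) : EuclideanSpace ℝ (Fin c → Fin d) :=
  WithLp.toLp 2 fun k => ∏ i, w (k i)

theorem norm_tensorPow {d : ℕ} (c : ℕ) {w : Fin d → ℝ} (hw : ∑ k, w k ^ 2 = 1) :
    ‖tensorPow c w‖ = 1 := by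
  have h : ‖tensorPow c w‖ ^ 2 = 1 := by
    rw [EuclideanSpace.real_norm_sq_eq]
    have h := Finset.prod_univ_sum (fun _ : Fin c => Finset.univ) fun _ (k : Fin d) => w k ^ 2
    simp only [Fintype.piFinset_univ, hw, Finset.prod_const_one, Finset.prod_pow] at h
    exact h.symm
  exact (pow_eq_one_iff_of_nonneg (norm_nonneg _) two_ne_zero).1 h

theorem norm_sq_tensorSketch_mulVec_tensorPow {c m d : ℕ} {Ω : Type*} [MeasurableSpace Ω]
    (M : Fin c → Ω → Matrix (Fin m) (Fin d) ℝ) (ω : Ω) (w : Fin d → ℝ) :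
    ‖WithLp.toLp 2 (Matrix.mulVec (tensorSketch M ω) (tensorPow c w).ofLp)‖ ^ 2
      = (∑ j, rowForm w fun i => M i ω j) / m := by
  rw [EuclideanSpace.real_norm_sq_eq, Finset.sum_div]
  refine Finset.sum_congr rfl fun j _ => ?_
  have h : Matrix.mulVec (tensorSketch M ω) (tensorPow c w).ofLp j
      = 1 / √(m : ℝ) * ∏ i, ∑ k, w k * M i ω j k := by
    rw [Finset.prod_univ_sum, Fintype.piFinset_univ, Finset.mul_sum]
    refine Finset.sum_congr rfl fun k _ => ?_
    simp only [tensorSketch, faceSplitting, tensorPow, Matrix.smul_apply, Matrix.of_apply,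
      smul_eq_mul, Finset.prod_mul_distrib]
    ring
  change (Matrix.mulVec (tensorSketch M ω) (tensorPow c w).ofLp j) ^ 2 = _
  rw [h, mul_pow, div_pow, Real.sq_sqrt (Nat.cast_nonneg m), rowForm, Finset.prod_pow]
  ring

theorem expect_rowForm_pow {d : ℕ} (c p : ℕ) :
    (𝔼 s : Fin c → Fin d → ℤˣ, rowForm (fun _ => 1 / √(d : ℝ)) (signRow s) ^ p)
      = ((𝔼 x : Fin d → ℤˣ, (∑ k, ((x k : ℤ) : ℝ)) ^ (2 * p)) / d ^ p) ^ c := by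
  have h (x : Fin d → ℤˣ) : ((∑ k, 1 / √(d : ℝ) * ((x k : ℤ) : ℝ)) ^ 2) ^ p
      = (∑ k, ((x k : ℤ) : ℝ)) ^ (2 * p) / d ^ p := by
    rw [← Finset.mul_sum, mul_pow, div_pow, Real.sq_sqrt (Nat.cast_nonneg d), mul_pow, ← pow_mul]
    simp [div_eq_inv_mul]
  simp only [rowForm, signRow, ← Finset.prod_pow]
  rw [expect_prod_fin c fun x : Fin d → ℤˣ => ((∑ k, 1 / √(d : ℝ) * ((x k : ℤ) : ℝ)) ^ 2) ^ p]
  simp only [h, Finset.expect_div]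

theorem rowForm_nonneg {c d : ℕ} (w : Fin d → ℝ) (r : Fin c → Fin d → ℝ) : 0 ≤ rowForm w r :=
  Finset.prod_nonneg fun _ _ => sq_nonneg _

variable {d : ℕ} (c : ℕ)

theorem expect_rowForm_sub_one (hd : 1 ≤ d) :
    (𝔼 s : Fin c → Fin d → ℤˣ, (rowForm (fun _ => 1 / √(d : ℝ)) (signRow s) - 1)) = 0 := by
  have hd' : (d : ℝ) ≠ 0 := by positivity
  have h := expect_rowForm_pow (d := d) c 1
  simp only [pow_one, mul_one, expect_sign_sum_sq, div_self hd', one_pow] at h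
  rw [Finset.expect_sub_distrib, h, Fintype.expect_const, sub_self]

theorem expect_rowForm_sub_one_sq (hd : 1 ≤ d) :
    (𝔼 s : Fin c → Fin d → ℤˣ, (rowForm (fun _ => 1 / √(d : ℝ)) (signRow s) - 1) ^ 2)
      = (3 - 2 / d : ℝ) ^ c - 1 := by
  have hd' : (d : ℝ) ≠ 0 := by positivity
  have h1 := expect_rowForm_pow (d := d) c 1
  have h2 := expect_rowForm_pow (d := d) c 2
  simp only [pow_one, mul_one, expect_sign_sum_sq, div_self hd', one_pow] at h1
  norm_num only at h2
  rw [expect_sign_sum_pow_four] at h2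
  have h (x : ℝ) : (x - 1) ^ 2 = x ^ 2 - 2 * x + 1 := by ring
  simp only [h, Finset.expect_add_distrib, Finset.expect_sub_distrib, ← Finset.mul_expect, h1, h2,
    Fintype.expect_const]
  rw [show (3 * (d : ℝ) ^ 2 - 2 * d) / d ^ 2 = 3 - 2 / d by field_simp]
  ring

theorem expect_rowForm_sub_one_pow_four_le (hd : 1 ≤ d) :
    (𝔼 s : Fin c → Fin d → ℤˣ, (rowForm (fun _ => 1 / √(d : ℝ)) (signRow s) - 1) ^ 4)
      ≤ 2 * 105 ^ c := by
  have hd' : (0 : ℝ) < d := by positivity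
  have h4 := expect_rowForm_pow (d := d) c 4
  have h (s : Fin c → Fin d → ℤˣ) : (rowForm (fun _ => 1 / √(d : ℝ)) (signRow s) - 1) ^ 4
      ≤ rowForm (fun _ => 1 / √(d : ℝ)) (signRow s) ^ 4 + 1 := by
    have := rowForm_nonneg (fun _ => 1 / √(d : ℝ)) (signRow s)
    rcases le_total 1 (rowForm (fun _ => 1 / √(d : ℝ)) (signRow s)) with h | h
    · have := pow_le_pow_left₀ (by linarith)
        (by linarith : rowForm (fun _ => 1 / √(d : ℝ)) (signRow s) - 1
          ≤ rowForm (fun _ => 1 / √(d : ℝ)) (signRow s)) 4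
      linarith
    · rw [← Even.neg_pow (by decide)]
      have := pow_le_one₀ (n := 4) (by linarith)
        (by linarith : -(rowForm (fun _ => 1 / √(d : ℝ)) (signRow s) - 1) ≤ 1)
      linarith [pow_nonneg (rowForm_nonneg (fun _ => 1 / √(d : ℝ)) (signRow s)) 4]
  refine (Finset.expect_le_expect fun s _ => h s).trans ?_
  rw [Finset.expect_add_distrib, h4, Fintype.expect_const]
  have h8 : (𝔼 x : Fin d → ℤˣ, (∑ k, ((x k : ℤ) : ℝ)) ^ (2 * 4)) / d ^ 4 ≤ 105 := by
    rw [div_le_iff₀ (by positivity)]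
    exact expect_sign_sum_pow_eight_le d
  have h0 : 0 ≤ (𝔼 x : Fin d → ℤˣ, (∑ k, ((x k : ℤ) : ℝ)) ^ (2 * 4)) / d ^ 4 :=
    div_nonneg (Finset.expect_nonneg fun x _ => Even.pow_nonneg (by decide) _) (by positivity)
  have := pow_le_pow_left₀ h0 h8 c
  have := one_le_pow₀ (n := c) (by norm_num : (1 : ℝ) ≤ 105)
  linarith

end RowForm

/-! ### From the probability space to counting sign patterns -/

section Transfer

theorem rademacher_singleton_units (u : ℤˣ) : rademacher {((u : ℤ) : ℝ)} = 2⁻¹ := by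
  rcases Int.units_eq_one_or u with rfl | rfl <;>
  simp [rademacher, Set.indicator]
  all_goals norm_num

/-- The probability of an event in terms of the sign matrices is at least
the proportion of sign patterns that satisfy it. -/
theorem IsIndepRademacher.expect_le_measureReal {c m d : ℕ} {Ω : Type*} [MeasurableSpace Ω]
    {P : Measure Ω} [IsProbabilityMeasure P] {M : Fin c → Ω → Matrix (Fin m) (Fin d) ℝ}
    (hM : IsIndepRademacher P M) (T : (Fin m → Fin c → Fin d → ℝ) → Prop) [DecidablePred T] :
    (𝔼 s : Fin m → Fin c → Fin d → ℤˣ, if T (fun j => signRow (s j)) then (1 : ℝ) else 0)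
      ≤ P.real {ω | T fun j i => M i ω j} := by
  let E (s : Fin m → Fin c → Fin d → ℤˣ) : Set Ω :=
    ⋂ q : Fin c × Fin m × Fin d,
      (fun ω => M q.1 ω q.2.1 q.2.2) ⁻¹' {((s q.2.1 q.1 q.2.2 : ℤ) : ℝ)}
  have hE (s) : P.real (E s)
      = (Fintype.card (Fin m → Fin c → Fin d → ℤˣ) : ℝ)⁻¹ := by
    have h := hM.indep.measure_inter_preimage_eq_mul Finset.univ
      (sets := fun q => {((s q.2.1 q.1 q.2.2 : ℤ) : ℝ)}) (fun q _ => measurableSet_singleton _)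
    simp only [Finset.mem_univ, Set.iInter_true] at h
    have h' (q : Fin c × Fin m × Fin d) : P ((fun ω => M q.1 ω q.2.1 q.2.2) ⁻¹'
        {((s q.2.1 q.1 q.2.2 : ℤ) : ℝ)}) = 2⁻¹ := by
      rw [← Measure.map_apply_of_aemeasurable (hM.hasLaw _ _ _).aemeasurable
        (measurableSet_singleton _), (hM.hasLaw _ _ _).map_eq, rademacher_singleton_units]
    simp only [h', Finset.prod_const] at h
    rw [measureReal_def, h]
    simp [← pow_mul]
    ring
  -- Entries are only a.e. measurable, hence null-measurability. The target event needs none, as it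
  -- merely contains a disjoint union of the cells `E s`.
  have hnull (s) : NullMeasurableSet (E s) P :=
    NullMeasurableSet.iInter fun q =>
      (hM.hasLaw _ _ _).aemeasurable.nullMeasurableSet_preimage (measurableSet_singleton _)
  have hmem {s ω} (h : ω ∈ E s) (j i k) : M i ω j k = ((s j i k : ℤ) : ℝ) := by
    simpa using Set.mem_iInter.1 h (i, j, k)
  have hdisj (s t) (hst : s ≠ t) : Disjoint (E s) (E t) := by
    rw [Set.disjoint_left]
    intro ω hs ht
    refine hst ?_
    ext j i k
    have := (hmem hs j i k).symm.trans (hmem ht j i k)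
    exact_mod_cast this
  rw [Fintype.expect_eq_sum_div_card, Finset.sum_boole, div_eq_mul_inv, ← nsmul_eq_mul,
    ← Finset.sum_const]
  rw [← Finset.sum_congr rfl fun s _ => hE s,
    ← measureReal_biUnion_finset₀ (fun s _ t _ hst => (hdisj s t hst).aedisjoint)
      (fun s _ => hnull s)]
  refine measureReal_mono ?_
  refine Set.iUnion₂_subset fun s hs ω hω => ?_
  have : (fun j i => M i ω j) = fun j => signRow (s j) := by
    ext j i k
    exact hmem hω j i k
  simpa [this] using hs

end Transfer

/-! ### Heavy tail from a single row -/

section Flip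

/-- The unit vector that is constant on the first `n` coordinates and vanishes on the others. -/
noncomputable def flatVec (d n : ℕ) (k : Fin d) : ℝ := if (k : ℕ) < n then 1 / √(n : ℝ) else 0

theorem sum_fin_ite_lt {d n : ℕ} (h : n ≤ d) (a : ℝ) :
    ∑ k : Fin d, (if (k : ℕ) < n then a else 0) = n * a := by
  rw [Fin.sum_univ_eq_sum_range (fun k => if k < n then a else 0), ← Finset.sum_filter]
  rw [show (Finset.range d).filter (· < n) = Finset.range n by ext; simp; omega]
  simp

theorem sum_flatVec_sq {d n : ℕ} (hn : 0 < n) (h : n ≤ d) : ∑ k, flatVec d n k ^ 2 = 1 := by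
  have hn' : (0 : ℝ) < n := by positivity
  simp only [flatVec, ite_pow, div_pow, Real.sq_sqrt hn'.le]
  refine Eq.trans ?_ ((sum_fin_ite_lt h (1 / (n : ℝ))).trans (mul_one_div_cancel hn'.ne'))
  simp

theorem sum_flatVec {d n : ℕ} (hn : 0 < n) (h : n ≤ d) : (∑ k, flatVec d n k) ^ 2 = n := by
  have hn' : (0 : ℝ) < n := by positivity
  simp only [flatVec]
  rw [sum_fin_ite_lt h, mul_pow, div_pow, Real.sq_sqrt hn'.le]
  field_simp

theorem sum_flatVec_mul_sign {d h : ℕ} (hd : 2 * h ≤ d) :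
    ∑ k : Fin d, flatVec d (2 * h) k * (if (k : ℕ) < h then -1 else 1) = 0 := by
  have (k : Fin d) : flatVec d (2 * h) k * (if (k : ℕ) < h then -1 else 1)
      = (if (k : ℕ) < 2 * h then 1 / √((2 * h : ℕ) : ℝ) else 0)
        - if (k : ℕ) < h then 2 * (1 / √((2 * h : ℕ) : ℝ)) else 0 := by
    unfold flatVec
    split_ifs <;> first | (exfalso; omega) | ring
  simp only [this, Finset.sum_sub_distrib]
  rw [sum_fin_ite_lt hd, sum_fin_ite_lt (by omega)]
  push_cast
  ring

theorem expect_pattern {m c d n : ℕ} (hn : n ≤ d) (j₀ : Fin m) :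
    (𝔼 s : Fin m → Fin c → Fin d → ℤˣ,
      if ∀ i (k : Fin d), (k : ℕ) < n → s j₀ i k = 1 then (1 : ℝ) else 0)
      = 1 / 2 ^ (n * c) := by
  have hset : (Finset.univ.filter fun s : Fin m → Fin c → Fin d → ℤˣ =>
        ∀ i (k : Fin d), (k : ℕ) < n → s j₀ i k = 1)
      = Fintype.piFinset fun j => Fintype.piFinset fun _ => Fintype.piFinset fun k : Fin d =>
          if j = j₀ ∧ (k : ℕ) < n then {1} else Finset.univ := by
    ext s
    simp only [Finset.mem_filter, Finset.mem_univ, true_and, Fintype.mem_piFinset]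
    constructor
    · intro h j i k
      split_ifs with hk
      · simp [hk.1, h i k hk.2]
      · exact Finset.mem_univ _
    · intro h i k hk
      simpa [hk] using h j₀ i k
  rw [Fintype.expect_eq_sum_div_card, Finset.sum_boole, hset,
    div_eq_div_iff (by positivity) (by positivity)]
  have h1 : ∏ j : Fin m, ∏ _i : Fin c, ∏ k : Fin d, (if j = j₀ ∧ (k : ℕ) < n then 2 else 1)
      = 2 ^ (n * c) := by
    rw [Finset.prod_eq_single j₀ (by intro j _ hj; simp [hj]) (by simp)]
    have : ∏ k : Fin d, (if (k : ℕ) < n then 2 else 1) = 2 ^ n := by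
      rw [Fin.prod_univ_eq_prod_range (fun k => if k < n then 2 else 1), ← Finset.prod_filter,
        show (Finset.range d).filter (· < n) = Finset.range n by ext; simp; omega]
      simp
    simp [this, pow_mul]
  norm_cast
  rw [← h1, one_mul]
  simp only [Fintype.card_piFinset, Fintype.card_pi, ← Finset.prod_mul_distrib]
  refine Finset.prod_congr rfl fun j _ => Finset.prod_congr rfl fun i _ =>
    Finset.prod_congr rfl fun k _ => ?_
  split_ifs <;> simp

/-- Flipping half of the relevant signs of one factor of one row changes the quadratic form
by `(2 * h) ^ c`, so that one of two equally likely sign patterns is at distance more than `t`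
from `m`. -/
theorem expect_abs_sum_rowForm_flatVec_ge {m c d h : ℕ} (hm : 1 ≤ m) (hc : 1 ≤ c) (hh : 1 ≤ h)
    (hd : 2 * h ≤ d) {t : ℝ} (ht : 2 * t < ((2 * h : ℕ) : ℝ) ^ c) :
    1 / 2 ^ (2 * h * c + 1) ≤ 𝔼 s : Fin m → Fin c → Fin d → ℤˣ,
      if t < |(∑ j, rowForm (flatVec d (2 * h)) (signRow (s j))) - m| then (1 : ℝ) else 0 := by
  let j₀ : Fin m := ⟨0, hm⟩
  let i₀ : Fin c := ⟨0, hc⟩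
  let g : Fin m → Fin c → Fin d → ℤˣ := fun j i k =>
    if j = j₀ ∧ i = i₀ ∧ (k : ℕ) < h then -1 else 1
  let S (s : Fin m → Fin c → Fin d → ℤˣ) : ℝ :=
    (∑ j, rowForm (flatVec d (2 * h)) (signRow (s j))) - m
  have key (s : Fin m → Fin c → Fin d → ℤˣ)
      (hs : ∀ i (k : Fin d), (k : ℕ) < 2 * h → s j₀ i k = 1) :
      S s - S (g * s) = ((2 * h : ℕ) : ℝ) ^ c := by
    have hw (i) (k : Fin d) : flatVec d (2 * h) k * signRow (s j₀) i k = flatVec d (2 * h) k := by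
      by_cases hk : (k : ℕ) < 2 * h
      · simp [signRow, hs i k hk]
      · simp [flatVec, hk]
    have h1 : rowForm (flatVec d (2 * h)) (signRow (s j₀)) = ((2 * h : ℕ) : ℝ) ^ c := by
      simp only [rowForm, hw, sum_flatVec (by omega : 0 < 2 * h) hd]
      simp
    have h2 : rowForm (flatVec d (2 * h)) (signRow ((g * s) j₀)) = 0 := by
      refine Finset.prod_eq_zero (Finset.mem_univ i₀) ?_
      rw [sq_eq_zero_iff, ← sum_flatVec_mul_sign hd]
      refine Finset.sum_congr rfl fun k _ => ?_
      have : signRow ((g * s) j₀) i₀ k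
          = signRow (s j₀) i₀ k * (if (k : ℕ) < h then -1 else 1) := by
        by_cases hk : (k : ℕ) < h <;> simp [signRow, g, hk]
      rw [this, ← mul_assoc, hw]
    have h3 (j) (hj : j ≠ j₀) : (g * s) j = s j := by
      ext i k
      simp [g, hj]
    simp only [S, sub_sub_sub_cancel_right]
    rw [← Finset.sum_sub_distrib, Finset.sum_eq_single j₀ (by intro j _ hj; rw [h3 j hj, sub_self])
      (by simp), h1, h2, sub_zero]
  have hflip : (𝔼 s, if t < |S (g * s)| then (1 : ℝ) else 0)
      = 𝔼 s, if t < |S s| then (1 : ℝ) else 0 :=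
    Fintype.expect_equiv (Equiv.mulLeft g) _ _ fun _ => rfl
  have hle : (1 : ℝ) / 2 ^ (2 * h * c) ≤ (𝔼 s, if t < |S s| then (1 : ℝ) else 0)
      + 𝔼 s, if t < |S (g * s)| then (1 : ℝ) else 0 := by
    rw [← expect_pattern hd j₀, ← Finset.expect_add_distrib]
    refine Finset.expect_le_expect fun s _ => ?_
    by_cases hs : ∀ i (k : Fin d), (k : ℕ) < 2 * h → s j₀ i k = 1
    · have hk := key s hs
      rw [if_pos hs]
      by_cases h1 : t < |S s|
      · rw [if_pos h1]
        split_ifs <;> norm_num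
      · have h2 : t < |S (g * s)| := by
          have := abs_le.1 (not_lt.1 h1)
          rw [lt_abs]
          right
          linarith [this.2]
        rw [if_pos h2]
        split_ifs
        norm_num
    · rw [if_neg hs]
      split_ifs <;> norm_num
  rw [hflip] at hle
  change 1 / 2 ^ (2 * h * c + 1) ≤ 𝔼 s, if t < |S s| then (1 : ℝ) else 0
  rw [pow_succ, ← div_div]
  linarith

end Flip

/-! ### Gaussian range -/

section LowerBound

theorem abs_div_sub_one_lt_iff {m : ℕ} (hm : 1 ≤ m) (ε S : ℝ) :
    ε < |S / m - 1| ↔ ε * m < |S - m| := by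
  have hm' : (0 : ℝ) < m := by positivity
  rw [div_sub_one hm'.ne', abs_div, abs_of_pos hm', lt_div_iff₀ hm']

/-- Bernoulli's inequality for `3 - 2/d = 3 (1 - 2/(3d))`, where `24c ≤ d` keeps the loss below
`1/36`. -/
theorem three_pow_div_two_le {c d : ℕ} (hc : 1 ≤ c) (hcd : 24 * c ≤ d) :
    (3 : ℝ) ^ c / 2 ≤ (3 - 2 / d : ℝ) ^ c - 1 := by
  have hcd' : (24 * c : ℝ) ≤ d := by exact_mod_cast hcd
  have hc' : (1 : ℝ) ≤ c := by exact_mod_cast hc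
  have hd : (0 : ℝ) < d := by linarith
  have hle : (2 / (3 * d) : ℝ) * c ≤ 1 / 36 := by
    rw [div_mul_eq_mul_div, div_le_iff₀ (by positivity)]
    linarith
  have h1 : (2 / (3 * d) : ℝ) ≤ 1 := by
    rw [div_le_iff₀ (by positivity)]
    linarith
  have hb := one_add_mul_le_pow (a := -(2 / (3 * d) : ℝ)) (by linarith) c
  have h3 : (3 : ℝ) ≤ 3 ^ c := le_self_pow₀ (by norm_num) (by omega)
  have : (3 - 2 / d : ℝ) = 3 * (1 + -(2 / (3 * d))) := by
    field_simp
    ring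
  rw [this, mul_pow]
  have hb' : (35 / 36 : ℝ) ≤ (1 + -(2 / (3 * d))) ^ c := by linarith
  nlinarith

/-- If `m` is large, then the quadratic form of the flat vector deviates from its mean by
`ε` with probability more than `exp (-L)`. -/
theorem exp_neg_lt_expect_rowForm {m c d h : ℕ} {L ε : ℝ} (hc : 1 ≤ c) (hcd : 24 * c ≤ d)
    (hh : 1 ≤ h) (hhL : (h : ℝ) ≤ L / c / 4) (hhL' : L / c / 8 ≤ h)
    (hm : 4 * 12 ^ c * (L / c) ≤ m) (hεm : ε ^ 2 * m < 1 / 10000 * (3 ^ c * (L / c))) :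
    Real.exp (-L) < 𝔼 s : Fin m → Fin c → Fin d → ℤˣ,
      if ε * m < |(∑ j, rowForm (fun _ => 1 / √(d : ℝ)) (signRow (s j))) - m|
        then (1 : ℝ) else 0 := by
  set u : ℝ := L / c
  have hc' : (1 : ℝ) ≤ c := by exact_mod_cast hc
  have hh' : (1 : ℝ) ≤ h := by exact_mod_cast hh
  have hu : 4 ≤ u := by linarith
  have huL : u ≤ L := by
    have : u * c = L := div_mul_cancel₀ _ (by positivity)
    nlinarith
  have h12 : (1 : ℝ) ≤ 12 ^ c := one_le_pow₀ (by norm_num)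
  have hmh : (h : ℝ) ≤ m := by nlinarith
  have hmh' : h ≤ m := by exact_mod_cast hmh
  have hm0 : (0 : ℝ) < m := by linarith
  set v : ℝ := (3 - 2 / d : ℝ) ^ c - 1
  have hv : (3 : ℝ) ^ c / 2 ≤ v := three_pow_div_two_le hc hcd
  have h3 : (0 : ℝ) < 3 ^ c := by positivity
  have hv0 : 0 < v := by linarith
  set b : ℕ := m / h
  have hb : 1 ≤ b := (Nat.one_le_div_iff (by omega)).2 hmh'
  have hbh : b * h ≤ m := Nat.div_mul_le_self m h
  have hb2 : (m : ℝ) ≤ 2 * (b * h) := by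
    have h1 : m < (b + 1) * h := Nat.lt_mul_of_div_lt (Nat.lt_succ_self _) (by omega)
    have h2 : h ≤ b * h := Nat.le_mul_of_pos_left _ hb
    have : m ≤ 2 * (b * h) := by linarith
    exact_mod_cast this
  have hb8 : (8 : ℝ) * 12 ^ c ≤ b := by
    have h1 : (b : ℝ) * h ≤ b * (u / 4) := by gcongr
    have h2 : 8 * 12 ^ c * u ≤ b * u := by linarith
    exact le_of_mul_le_mul_right h2 (by linarith)
  -- Here `12^c` in the bound on `m` is used: `12 · 3²= 108` exceeds `105`, so blocks are long
  -- enough for the fourth-moment argument.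
  have hF : (2 : ℝ) * 105 ^ c ≤ b * v ^ 2 := by
    calc (2 : ℝ) * 105 ^ c ≤ 2 * 108 ^ c := by gcongr; norm_num
      _ = 8 * 12 ^ c * (3 ^ c / 2) ^ 2 := by
        rw [show (108 : ℝ) = 12 * 3 * 3 by norm_num, mul_pow, mul_pow]; ring
      _ ≤ b * v ^ 2 := by gcongr
  obtain ⟨N, rfl⟩ : ∃ N, h = N + 1 := ⟨h - 1, by omega⟩
  have hd : 1 ≤ d := by omega
  have key := expect_sum_ge_blocks hv0 (expect_rowForm_sub_one c hd)
    (expect_rowForm_sub_one_sq c hd) (expect_rowForm_sub_one_pow_four_le c hd)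
    (by omega : 0 < b) hF N m (by linarith)
  have hexp : Real.exp (-L) < (1 / 20) ^ (N + 1) := by
    have h20 : (1 / 20 : ℝ) > Real.exp (-4) := by
      have h1 : (20 : ℝ) < Real.exp 4 := by
        have : Real.exp 4 = Real.exp 1 ^ 4 := by rw [← Real.exp_nat_mul]; norm_num
        rw [this]
        calc (20 : ℝ) < 2.7 ^ 4 := by norm_num
          _ ≤ Real.exp 1 ^ 4 := by
            gcongr
            linarith [Real.exp_one_gt_d9]
      rw [Real.exp_neg, one_div]
      exact inv_strictAnti₀ (by norm_num) h1
    calc Real.exp (-L) ≤ Real.exp (-4) ^ (N + 1) := by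
          rw [← Real.exp_nat_mul]
          gcongr
          linarith
      _ < _ := pow_lt_pow_left₀ h20 (Real.exp_pos _).le (by omega)
  refine hexp.trans_le (key.trans (Finset.expect_le_expect fun s _ => ?_))
  have hdev : ε * m < 0.15 * (N + 1) * √(b * v) := by
    refine lt_of_pow_lt_pow_left₀ 2 (by positivity) ?_
    rw [mul_pow (0.15 * ((N : ℝ) + 1)), Real.sq_sqrt (by positivity)]
    push_cast at *
    calc (ε * m) ^ 2 = ε ^ 2 * m * m := by ring
      _ < 1 / 10000 * (3 ^ c * u) * m := by gcongr
      _ ≤ 0.0225 * (u / 8) * (m / 2) * (3 ^ c / 2) := by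
        have : 0 ≤ 3 ^ c * u * m := by positivity
        linarith
      _ ≤ 0.0225 * (N + 1) * (b * (N + 1)) * v := by
        gcongr
        linarith
      _ = _ := by ring
  rw [Finset.sum_sub_distrib]
  simp only [Finset.sum_const, Finset.card_univ, Fintype.card_fin, nsmul_eq_mul, mul_one]
  split_ifs with h1 h2
  · exact le_rfl
  · exact absurd (hdev.trans_le (h1.trans (le_abs_self _))) h2
  · norm_num
  · exact le_rfl

end LowerBound

theorem mainTheorem5 :
    ∃ C₁ C₂ B : ℝ, 0 < C₁ ∧ 0 < C₂ ∧ 0 < B ∧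
      ∀ (d m c : ℕ) (ε δ : ℝ), 1 ≤ d → 1 ≤ m → 1 ≤ c →
        0 ≤ ε → ε ≤ 1 → 0 < δ → δ ≤ 1 / 16 →
        Real.log (1 / δ) ≤ (d : ℝ) → (c : ℝ) / B ≤ Real.log (1 / δ) →
        ∀ (Ω : Type*) [MeasurableSpace Ω] (P : Measure Ω) [IsProbabilityMeasure P]
          (M : Fin c → Ω → Matrix (Fin m) (Fin d) ℝ), IsIndepRademacher P M →
          ∃ y : EuclideanSpace ℝ (Fin c → Fin d), ‖y‖ = 1 ∧
            -- for `ε = 0` the bound on `m` is `+∞`, so there is no condition on `m`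
            ((ε = 0 ∨
              (m : ℝ) < C₁ * max (3 ^ c * (ε ^ 2)⁻¹ * (Real.log (1 / δ) / c))
                (ε⁻¹ * (C₂ * Real.log (1 / δ) / c) ^ c)) →
              δ < P.real {ω | ε < |‖WithLp.toLp 2 (Matrix.mulVec (tensorSketch M ω) y.ofLp)‖ ^ 2
                - 1|}) := by
  refine ⟨1 / 10000, 1 / 4, 1 / 24, by norm_num, by norm_num, by norm_num, ?_⟩
  intro d m c ε δ hd hm hc hε _ hδ _ hLd hcL Ω _ P _ M hM
  have hδL : δ = Real.exp (-Real.log (1 / δ)) := by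
    rw [one_div, Real.log_inv, neg_neg, Real.exp_log hδ]
  generalize Real.log (1 / δ) = L at *
  have hc' : (1 : ℝ) ≤ c := by exact_mod_cast hc
  have hcL' : 24 * c ≤ L := by linarith
  have hcd : 24 * c ≤ d := by exact_mod_cast hcL'.trans hLd
  rw [mul_div_assoc]
  have hucL : L / c * c = L := div_mul_cancel₀ _ (by positivity)
  have hu : 24 ≤ L / c := (le_div_iff₀ (by positivity)).2 hcL'
  set u : ℝ := L / c 
  have huL : u ≤ L := by nlinarith
  set h : ℕ := ⌊u / 4⌋₊
  have hhu : (h : ℝ) ≤ u / 4 := Nat.floor_le (by linarith)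
  have hhu' : u / 8 ≤ h := by linarith [Nat.lt_floor_add_one (u / 4)]
  have hh : 1 ≤ h := Nat.le_floor (by push_cast; linarith)
  have hhd : 2 * h ≤ d := by
    have : (2 * h : ℝ) ≤ d := by linarith
    exact_mod_cast this
  have hm' : (0 : ℝ) < m := by positivity
  -- The first case needs no upper bound on `m` and includes `ε = 0`. Its cost is `2hc + 1 ≤ L/2 + 1
  -- < L` bits.
  by_cases H : 2 * (ε * m) < ((2 * h : ℕ) : ℝ) ^ c
  · refine ⟨tensorPow c (flatVec d (2 * h)), norm_tensorPow c (sum_flatVec_sq (by omega) hhd),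
      fun _ => ?_⟩
    simp only [norm_sq_tensorSketch_mulVec_tensorPow, abs_div_sub_one_lt_iff hm]
    refine lt_of_lt_of_le ?_ ((expect_abs_sum_rowForm_flatVec_ge hm hc hh hhd H).trans
      (hM.expect_le_measureReal fun r =>
        ε * m < |(∑ j, rowForm (flatVec d (2 * h)) (r j)) - m|))
    rw [hδL, Real.exp_neg, one_div]
    refine inv_strictAnti₀ (by positivity) ?_
    calc (2 : ℝ) ^ (2 * h * c + 1) ≤ Real.exp 1 ^ (2 * h * c + 1) := by
          gcongr
          linarith [Real.exp_one_gt_d9]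
      _ = Real.exp (2 * h * c + 1) := by rw [← Real.exp_nat_mul]; push_cast; ring_nf
      _ < Real.exp L := by
        gcongr
        have : (h : ℝ) * c ≤ u / 4 * c := by gcongr
        linarith
  · refine ⟨tensorPow c fun _ => 1 / √(d : ℝ), norm_tensorPow c ?_, fun hcond => ?_⟩
    · have : (d : ℝ) ≠ 0 := by positivity
      simp [this]
    have hHu : (u / 4) ^ c ≤ 2 * (ε * m) := by
      refine le_trans ?_ (not_lt.1 H)
      gcongr
      push_cast
      linarith
    have hu4 : 0 < (u / 4) ^ c := by positivity
    have hε0 : 0 < ε := by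
      refine hε.lt_of_ne fun h0 => ?_
      rw [← h0] at hHu
      linarith
    have hεm : ε ^ 2 * m < 1 / 10000 * (3 ^ c * u) := by
      rcases hcond with h0 | hcond
      · exact absurd h0 hε0.ne'
      rw [mul_max_of_nonneg _ _ (by norm_num), lt_max_iff] at hcond
      rcases hcond with h1 | h1
      · have := mul_lt_mul_of_pos_left h1 (by positivity : 0 < ε ^ 2)
        refine this.trans_eq ?_
        field_simp
      -- The second bound would give `εm < (u/4)^c / 10000`, against `hHu`.
      · have h2 := mul_lt_mul_of_pos_left h1 hε0
        have h3 : ε * (1 / 10000 * (ε⁻¹ * (1 / 4 * u) ^ c)) = 1 / 10000 * (u / 4) ^ c := by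
          rw [show 1 / 4 * u = u / 4 by ring]
          field_simp
        linarith
    -- Otherwise squaring `hHu` gives `36^c (u²/576)^c < 0.0016 · 36^c u²`. But `u ≥ 24`, which is
    -- where `B = 1/24` enters, makes the left side at least `36^c u²/576`, and `1/576 > 0.0016`.
    have hmu : 4 * 12 ^ c * u ≤ m := by
      by_contra! hlt
      have h1 : (u / 4) ^ c * (u / 4) ^ c ≤ 2 * (ε * m) * (2 * (ε * m)) :=
        mul_self_le_mul_self hu4.le hHu
      have h2 : ε ^ 2 * m * m < 1 / 10000 * (3 ^ c * u) * (4 * 12 ^ c * u) :=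
        mul_lt_mul'' hεm hlt (by positivity) hm'.le
      have h3 : (u / 4) ^ c * (u / 4) ^ c = 3 ^ c * 12 ^ c * (u ^ 2 / 576) ^ c := by
        rw [← mul_pow, ← mul_pow, ← mul_pow]
        ring_nf
      have h4 : u ^ 2 / 576 ≤ (u ^ 2 / 576) ^ c :=
        le_self_pow₀ (by rw [le_div_iff₀ (by norm_num)]; nlinarith) (by omega)
      have h5 : (3 : ℝ) ^ c * 12 ^ c * (u ^ 2 / 576) ≤ 3 ^ c * 12 ^ c * (u ^ 2 / 576) ^ c := by
        gcongr
      have h6 : 0 < (3 : ℝ) ^ c * 12 ^ c * u ^ 2 := by positivity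
      linarith
    simp only [norm_sq_tensorSketch_mulVec_tensorPow, abs_div_sub_one_lt_iff hm]
    refine lt_of_lt_of_le ?_ (hM.expect_le_measureReal fun r =>
        ε * m < |(∑ j, rowForm (fun _ => 1 / √(d : ℝ)) (r j)) - m|)
    rw [hδL]
    exact exp_neg_lt_expect_rowForm hc hcd hh hhu hhu' hmu hεm
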